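/- Let $X$ be a scheme and let $\mathcal{O}_X\text{-Mod}$ be the category of all sheaves of $\mathcal{O}_X$-modules. A short exact sequence in $\mathcal{O}_X\text{-Mod}$ is called g-pure exact if it stays exact after applying the sheaf tensor product $-\otimes_{\mathcal{O}_X}\mathcal{Y}$ for every $\mathcal{O}_X$-module $\mathcal{Y}$, and an $\mathcal{O}_X$-module $\mathcal{N}$ is called g-pure-injective if the functor $\operatorname{Hom}_{\mathcal{O}_X}(-,\mathcal{N})$ is exact on g-pure exact sequences. Similarly, for a commutative ring $R$, a short exact sequence of $R$-modules is pure-exact if it stays exact after applying $-\otimes_R Y$ for every $R$-module $Y$, and an $R$-module $N$ is pure-injective if $\operatorname{Hom}_R(-,N)$ is exact on pure-exact sequences. An object is indecomposable if it is non-zero and is not a direct sum of two non-zero objects. For $x\in X$ and an $\mathcal{O}_{X,x}$-module $N$, the skyscraper $\iota_{x,*}(N)$ is the $\mathcal{O}_X$-module with sections $N$ over the open sets $U$ containing $x$ and $0$ over all other open sets. Let $\mathcal{N}$ be an indecomposable g-pure-injective $\mathcal{O}_X$-module. Then there are a point $x\in X$ and an indecomposable pure-injective $\mathcal{O}_{X,x}$-module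 $N$ such that $\mathcal{N}\cong\iota_{x,*}(N)$. -/

import Mathlib

universe u

open CategoryTheory Limits MonoidalCategory AlgebraicGeometry TopologicalSpace

noncomputable section

namespace GPurity

section Modules

variable {R : Type u} [CommRing R]

/-- A short exact sequence of `R`-modules is pure-exact if it stays short exact after applying
`- ⊗ Y` for every `R`-module `Y`. -/
structure IsPureExact (S : ShortComplex (ModuleCat.{u} R)) : Prop where
  shortExact : S.ShortExact
  tensor (Y : ModuleCat.{u} R) : (S.map (tensorRight Y)).ShortExact

/-- An `R`-module `N` is pure-injective if `Hom(-, N)` is exact on pure-exact sequences. -/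
def IsPureInjective (N : ModuleCat.{u} R) : Prop :=
  ∀ S : ShortComplex (ModuleCat.{u} R), IsPureExact S →
    (S.op.map (preadditiveYoneda.obj N)).ShortExact

end Modules

section Sheaves

variable {X : Scheme.{u}}

/-- The presheaf tensor product functor `A ↦ (U ↦ A(U) ⊗ Y(U))`. -/
def presheafTensor (Y : X.PresheafOfModules) : X.PresheafOfModules ⥤ X.PresheafOfModules :=
  tensorRight (C := PresheafOfModules.{u} (X.presheaf ⋙ forget₂ CommRingCat RingCat)) Y

/-- Sheafification of presheaves of modules over a scheme. -/
def sheafification (X : Scheme.{u}) : X.PresheafOfModules ⥤ X.Modules :=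
  PresheafOfModules.sheafification (𝟙 X.ringCatSheaf.obj)

/-- The sheaf tensor product functor `- ⊗ Y` on `𝒪_X`-modules: the sheafification of the
presheaf tensor product. -/
def sheafTensor (Y : X.Modules) : X.Modules ⥤ X.Modules :=
  Scheme.Modules.toPresheafOfModules X ⋙
    presheafTensor ((Scheme.Modules.toPresheafOfModules X).obj Y) ⋙ sheafification X

instance (Y : X.Modules) : (sheafTensor Y).PreservesZeroMorphisms where
  map_zero A B := by
    have h : (presheafTensor ((Scheme.Modules.toPresheafOfModules X).obj Y)).map
        ((Scheme.Modules.toPresheafOfModules X).map (0 : A ⟶ B)) = 0 := by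
      ext U : 1
      exact MonoidalPreadditive.zero_whiskerRight (C := ModuleCat (X.presheaf.obj U))
    have : (sheafification X).IsLeftAdjoint :=
      (PresheafOfModules.sheafificationAdjunction (𝟙 X.ringCatSheaf.obj)).isLeftAdjoint
    change (sheafification X).map _ = 0
    rw [h, Functor.map_zero]

/-- A short exact sequence of `𝒪_X`-modules is geometrically pure if it stays short exact after
applying the sheaf tensor product `- ⊗ Y` for every `𝒪_X`-module `Y`. -/
structure IsGPureExact (S : ShortComplex X.Modules) : Prop where
  shortExact : S.ShortExact
  tensor (Y : X.Modules) : (S.map (sheafTensor Y)).ShortExact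

/-- An `𝒪_X`-module `N` is g-pure-injective if `Hom(-, N)` is exact on g-pure exact sequences. -/
def IsGPureInjective (N : X.Modules) : Prop :=
  ∀ S : ShortComplex X.Modules, IsGPureExact S →
    (S.op.map (preadditiveYoneda.obj N)).ShortExact

end Sheaves

section Skyscraper

variable {X : Scheme.{u}} (x : X) (N : ModuleCat.{u} (X.presheaf.stalk x))

/-- The sections over `U` of the skyscraper with value `N` at `x`: functions to `N` from the
type of proofs of `x ∈ U`, that is `N` if `x ∈ U` and `0` otherwise. -/
abbrev SkyscraperSections (U : X.Opens) : Type u := PLift (x ∈ U) → N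

/-- A section of `𝒪_X` over `U` acts through its germ at `x`. -/
instance skyscraperModule (U : X.Opens) : Module Γ(X, U) (SkyscraperSections x N U) where
  smul r s h := X.presheaf.germ U x h.down r • s h
  one_smul s := funext fun h => by
    change X.presheaf.germ U x h.down 1 • s h = s h
    rw [map_one, one_smul]
  mul_smul r r' s := funext fun h => by
    change X.presheaf.germ U x h.down (r * r') • s h =
      X.presheaf.germ U x h.down r • X.presheaf.germ U x h.down r' • s h
    rw [map_mul, mul_smul]
  smul_zero r := funext fun h => smul_zero (X.presheaf.germ U x h.down r)
  smul_add r s s' := funext fun h => smul_add (X.presheaf.germ U x h.down r) (s h) (s' h)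
  add_smul r r' s := funext fun h => by
    change X.presheaf.germ U x h.down (r + r') • s h =
      X.presheaf.germ U x h.down r • s h + X.presheaf.germ U x h.down r' • s h
    rw [map_add, add_smul]
  zero_smul s := funext fun h => by
    change X.presheaf.germ U x h.down 0 • s h = 0
    rw [map_zero, zero_smul]

/-- The underlying presheaf of abelian groups of the skyscraper; the restriction maps are the
identity of `N` or zero. -/
def skyscraperAb : TopCat.Presheaf Ab.{u} X where
  obj U := AddCommGrpCat.of (SkyscraperSections x N U.unop)
  map {U V} i := AddCommGrpCat.ofHom
    { toFun := fun s h => s ⟨i.unop.le h.down⟩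
      map_zero' := rfl
      map_add' := fun _ _ => rfl }

/-- The skyscraper as a presheaf of modules. -/
def skyscraperPresheafOfModules : X.PresheafOfModules :=
  letI (U : (Opens X)ᵒᵖ) : Module (X.ringCatSheaf.obj.obj U) ((skyscraperAb x N).obj U) :=
    skyscraperModule x N U.unop
  PresheafOfModules.ofPresheaf (skyscraperAb x N) (by
    intro U V i r m
    funext h
    change X.presheaf.germ U.unop x (i.unop.le h.down) r • m ⟨i.unop.le h.down⟩ =
      X.presheaf.germ V.unop x h.down (X.presheaf.map i r) • m ⟨i.unop.le h.down⟩
    rw [← TopCat.Presheaf.germ_res_apply X.presheaf i.unop x h.down r]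
    rfl)

theorem skyscraper_isSheaf : (skyscraperAb x N).IsSheaf := by
  rw [TopCat.Presheaf.isSheaf_iff_isSheaf_comp (forget Ab.{u})]
  apply TopCat.Presheaf.isSheaf_of_isSheafUniqueGluing_types
  intro ι U sf hsf
  have key : ∀ i j (hi : x ∈ U i) (hj : x ∈ U j), sf i ⟨hi⟩ = sf j ⟨hj⟩ := fun i j hi hj =>
    congrFun (hsf i j) ⟨⟨hi, hj⟩⟩
  refine ⟨fun h => sf (Opens.mem_iSup.mp h.down).choose ⟨(Opens.mem_iSup.mp h.down).choose_spec⟩,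
    fun i => funext fun h => key _ _ _ h.down, fun s hs => funext fun h => ?_⟩
  exact congrFun (hs (Opens.mem_iSup.mp h.down).choose) ⟨(Opens.mem_iSup.mp h.down).choose_spec⟩

/-- The skyscraper `ι_{x,*}(N)` as an `𝒪_X`-module. -/
def skyscraper : X.Modules :=
  SheafOfModules.mk (skyscraperPresheafOfModules x N) (skyscraper_isSheaf x N)

end Skyscraper

end GPurity

end

/-!
Let `A` be a g-pure-injective sheaf of modules. The embedding of `A` into the product `G` of the
skyscrapers of its stalks stays a monomorphism after tensoring with any sheaf, because on stalks at
`x` it has a retraction, the projection of `G` to the factor at `x`. Hence `A` is a direct summand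
of `G` (`IsGPureInjective.exists_retraction`).

Let `U` be open. In `G` the sections supported outside `U` form the product of the factors at points
outside `U`. So the composite `A ⟶ G ⟶ G ⟶ A`, whose middle map kills the factors at the points of
`U`, is an idempotent with image the sections of `A` supported outside `U`. If `A` is
indecomposable, this idempotent is `0` or `1`. If it is `1`, then `A` vanishes on `U`. If it is `0`,
all restriction maps `A(W) → A(W ∩ U)` are injective, and they are always surjective since `G` is
flasque (`subsingleton_or_bijective_of_retraction`). It follows that the support of `A` is
irreducible and that `A` is the skyscraper of its stalk at the generic point `x` of the support
(`exists_generic_point`, `isIso_toSkyscraper`).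

The stalk inherits both properties, because the skyscraper functor is additive and fully faithful,
and because it sends pure-exact sequences to g-pure exact ones (`IsPureExact.skyscraper`): over an
open neighbourhood `U` of `x`, tensoring the skyscraper of `M` with `Y` gives
`M ⊗ Y(U) = M ⊗ (𝒪_{X,x} ⊗ Y(U))`, where the tensor product on the right is over `𝒪_{X,x}`.

The sheaf tensor product is handled through presheaves. The one fact needed about it is that
tensoring presheaves of modules preserves locally bijective maps
(`isLocallyInjective_whiskerRight_of_bijective`, `isLocallySurjective_whiskerRight`). For local
injectivity, the germ of a tensor `∑ mᵢ ⊗ yᵢ` depends only on its image in the tensor product of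
the stalk of the first factor with the sections of the second (`exists_stalk_tmul`).
-/

noncomputable section

namespace GPurity

open Opposite

/-! ### Germs in tensor products of presheaves of modules -/

section

variable {T : TopCat.{u}} {R : T.Presheaf CommRingCat.{u}}

/-- The restriction of sections of a presheaf of modules, as an additive map. -/
def res (M : PresheafOfModules.{u} (R ⋙ forget₂ _ _)) {U V : Opens T} (h : V ≤ U) :
    M.obj (op U) →+ M.obj (op V) :=
  (M.presheaf.map (homOfLE h).op).hom

/-- The stalk of a presheaf of modules; it is a module over the stalk of the structure presheaf. -/
abbrev Stalk (M : PresheafOfModules.{u} (R ⋙ forget₂ _ _)) (x : T) : Type u :=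
  (TopCat.Presheaf.stalk (C := Ab.{u}) M.presheaf x : Ab.{u})

/-- The germ of sections of a presheaf of modules, as an additive map. -/
def germ (M : PresheafOfModules.{u} (R ⋙ forget₂ _ _)) (U : Opens T) (x : T) (hx : x ∈ U) :
    M.obj (op U) →+ Stalk M x :=
  (TopCat.Presheaf.germ M.presheaf U x hx).hom

/-- The pure tensor `m ⊗ y` of two sections as a section of the presheaf tensor product. -/
def tmul (M Y : PresheafOfModules.{u} (R ⋙ forget₂ _ _)) (U : Opens T) (m : M.obj (op U))
    (y : Y.obj (op U)) : (M ⊗ Y : PresheafOfModules.{u} (R ⋙ forget₂ _ _)).obj (op U) :=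
  m ⊗ₜ[R.obj (op U)] y

variable (M Y : PresheafOfModules.{u} (R ⋙ forget₂ _ _))

lemma tmul_add (U : Opens T) (m : M.obj (op U)) (y y' : Y.obj (op U)) :
    tmul M Y U m (y + y') = tmul M Y U m y + tmul M Y U m y' :=
  TensorProduct.tmul_add (R := R.obj (op U)) ..

lemma add_tmul (U : Opens T) (m m' : M.obj (op U)) (y : Y.obj (op U)) :
    tmul M Y U (m + m') y = tmul M Y U m y + tmul M Y U m' y :=
  TensorProduct.add_tmul (R := R.obj (op U)) ..

lemma smul_tmul (U : Opens T) (r : R.obj (op U)) (m : M.obj (op U)) (y : Y.obj (op U)) :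
    tmul M Y U (r • m) y = tmul M Y U m (r • y) :=
  TensorProduct.smul_tmul (R := R.obj (op U)) ..

lemma res_tmul {U V : Opens T} (h : V ≤ U) (m : M.obj (op U)) (y : Y.obj (op U)) :
    res (M ⊗ Y) h (tmul M Y U m y) = tmul M Y V (res M h m) (res Y h y) :=
  PresheafOfModules.Monoidal.tensorObj_map_tmul ..

lemma res_smul {U V : Opens T} (h : V ≤ U) (r : R.obj (op U)) (m : M.obj (op U)) :
    res M h (r • m) = (R.map (homOfLE h).op r : R.obj (op V)) • res M h m :=
  M.map_smul ..

lemma res_res {U V W : Opens T} (h : V ≤ U) (h' : W ≤ V) (m : M.obj (op U)) :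
    res M h' (res M h m) = res M (h'.trans h) m :=
  ConcreteCategory.congr_hom (M.presheaf.map_comp (homOfLE h).op (homOfLE h').op).symm m

lemma res_self {U : Opens T} (m : M.obj (op U)) : res M le_rfl m = m :=
  ConcreteCategory.congr_hom (M.presheaf.map_id (op U)) m

lemma germ_res {U V : Opens T} (h : V ≤ U) (x : T) (hx : x ∈ V) (m : M.obj (op U)) :
    germ M V x hx (res M h m) = germ M U x (h hx) m :=
  TopCat.Presheaf.germ_res_apply M.presheaf (homOfLE h) x hx m

lemma germ_smul (U : Opens T) (x : T) (hx : x ∈ U) (r : R.obj (op U)) (m : M.obj (op U)) :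
    germ M U x hx (r • m) = R.germ U x hx r • germ M U x hx m :=
  PresheafOfModules.germ_smul M x U hx r m

lemma exists_germ_eq {U : Opens T} {x : T} (hx : x ∈ U) (t : Stalk M x) :
    ∃ (V : Opens T) (hV : x ∈ V) (_ : V ≤ U) (m : M.obj (op V)), germ M V x hV m = t := by
  obtain ⟨V, h, hV, m, hm⟩ := TopCat.Presheaf.exists_le_germ_eq M.presheaf t hx
  exact ⟨V, hV, h, m, hm⟩

lemma exists_res_eq {U : Opens T} {x : T} (hx : x ∈ U) {m m' : M.obj (op U)}
    (h : germ M U x hx m = germ M U x hx m') :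
    ∃ (V : Opens T) (_ : x ∈ V) (h : V ≤ U), res M h m = res M h m' := by
  obtain ⟨V, hV, i, j, hij⟩ := TopCat.Presheaf.germ_eq M.presheaf x hx hx m m' h
  exact ⟨V, hV, i.le, hij⟩

/-- Tensoring germs of `M` at `x` with sections of `Y` on a neighbourhood `U` of `x`: the germ of a
pure tensor `m ⊗ y` at `x` depends only on the germ of `m` and on `y`. -/
lemma exists_stalk_tmul (U : Opens T) (x : T) (hx : x ∈ U) :
    ∃ Φ : Stalk M x →+ Y.obj (op U) →+ Stalk (M ⊗ Y) x,
      ∀ (V : Opens T) (hV : x ∈ V) (h : V ≤ U) (m : M.obj (op V)) (y : Y.obj (op U)),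
        Φ (germ M V x hV m) y = germ (M ⊗ Y) V x hV (tmul M Y V m (res Y h y)) := by
  let φ (V : Opens T) (hV : x ∈ V) : M.obj (op V) →+ Y.obj (op U) →+ Stalk (M ⊗ Y) x :=
    AddMonoidHom.mk' (fun m => AddMonoidHom.mk' (fun y => germ (M ⊗ Y) (V ⊓ U) x ⟨hV, hx⟩
      (tmul M Y (V ⊓ U) (res M inf_le_left m) (res Y inf_le_right y)))
      fun a b => by rw [map_add, tmul_add, map_add])
      fun a b => by
        ext y
        change germ (M ⊗ Y) (V ⊓ U) x ⟨hV, hx⟩ _ = germ (M ⊗ Y) (V ⊓ U) x ⟨hV, hx⟩ _ +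
          germ (M ⊗ Y) (V ⊓ U) x ⟨hV, hx⟩ _
        rw [map_add, add_tmul, map_add]
  -- The maps `φ V` form a cocone over the neighbourhoods `V` of `x`; these are not assumed to be
  -- contained in `U`, hence the intersections `V ⊓ U`.
  have key (V W : Opens T) (hV : x ∈ V) (hW : x ∈ W) (h : W ≤ V) (m : M.obj (op V)) :
      φ W hW (res M h m) = φ V hV m := by
    ext y
    change germ (M ⊗ Y) (W ⊓ U) x ⟨hW, hx⟩ (tmul M Y (W ⊓ U) _ _) =
      germ (M ⊗ Y) (V ⊓ U) x ⟨hV, hx⟩ (tmul M Y (V ⊓ U) _ _)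
    rw [← germ_res (M ⊗ Y) (inf_le_inf_right U h) x ⟨hW, hx⟩, res_tmul]
    simp only [res_res]
  let c : Cocone ((OpenNhds.inclusion x).op ⋙ M.presheaf) :=
    { pt := AddCommGrpCat.of (Y.obj (op U) →+ Stalk (M ⊗ Y) x)
      ι :=
        { app V := AddCommGrpCat.ofHom (φ V.unop.1 V.unop.2)
          naturality V W i := by
            ext m : 2
            exact key V.unop.1 W.unop.1 V.unop.2 W.unop.2 (leOfHom i.unop) m } }
  refine ⟨(colimit.desc _ c).hom, fun V hV h m y => ?_⟩
  have e : (colimit.desc _ c).hom (germ M V x hV m) = φ V hV m :=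
    ConcreteCategory.congr_hom (colimit.ι_desc c (op ⟨V, hV⟩)) m
  refine (DFunLike.congr_fun e y).trans ?_
  change germ (M ⊗ Y) (V ⊓ U) x ⟨hV, hx⟩ (tmul M Y (V ⊓ U) _ _) = _
  rw [← germ_res (M ⊗ Y) inf_le_left x ⟨hV, hx⟩, res_tmul]
  simp only [res_res]

variable {M}

/-- If on every open `U` and at every point `x ∈ U` the germ map `M(U) → M_x` factors, as a
semilinear map, through `f : M(U) → M'(U)`, then `f ⊗ Y` is locally injective. -/
lemma isLocallyInjective_whiskerRight {M' : PresheafOfModules.{u} (R ⋙ forget₂ _ _)} (f : M ⟶ M')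
    (H : ∀ (U : Opens T) (x : T) (hx : x ∈ U), ∃ h : M'.obj (op U) →+ Stalk M x,
      (∀ (r : R.obj (op U)) (m : M'.obj (op U)), h (r • m) = R.germ U x hx r • h m) ∧
        ∀ m, h (f.app (op U) m) = germ M U x hx m) :
    Presheaf.IsLocallyInjective (Opens.grothendieckTopology T)
      ((PresheafOfModules.toPresheaf _).map (f ▷ Y)) := by
  constructor
  intro U s t hst x hx
  obtain ⟨U⟩ := U
  obtain ⟨h, h_smul, h_germ⟩ := H U x hx
  obtain ⟨Φ, hΦ⟩ := exists_stalk_tmul M Y U x hx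
  have Φ_smul (r : R.obj (op U)) (m : Stalk M x) (y : Y.obj (op U)) :
      Φ (R.germ U x hx r • m) y = Φ m (r • y) := by
    obtain ⟨V, hV, hVU, m, rfl⟩ := exists_germ_eq M hx m
    rw [← TopCat.Presheaf.germ_res_apply R (homOfLE hVU) x hV r, ← germ_smul,
      hΦ V hV hVU, hΦ V hV hVU, smul_tmul, ← res_smul]
  -- The germ map of `M ⊗ Y` at `x` factors through `f ⊗ Y` on sections over `U`.
  let Ψ : TensorProduct (R.obj (op U)) (M'.obj (op U)) (Y.obj (op U)) →+ Stalk (M ⊗ Y) x :=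
    TensorProduct.liftAddHom (Φ.comp h) fun r m y => by
      change Φ (h (r • m)) y = Φ (h m) (r • y)
      rw [h_smul, Φ_smul]
  have hΨ (z : (M ⊗ Y : PresheafOfModules.{u} (R ⋙ forget₂ _ _)).obj (op U)) :
      Ψ ((f ▷ Y).app (op U) z) = germ (M ⊗ Y) U x hx z := by
    refine TensorProduct.induction_on (R := R.obj (op U)) (M := M.obj (op U))
      (N := Y.obj (op U)) (motive := fun z => Ψ ((f ▷ Y).app (op U) z) =
        germ (M ⊗ Y) U x hx z) z ?_ (fun m y => ?_) fun a b ha hb => ?_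
    · erw [map_zero, map_zero]
    · change Φ (h (f.app (op U) m)) y = _
      rw [h_germ, hΦ U hx le_rfl, res_self]
      rfl
    · erw [map_add, map_add, map_add, ha, hb]
  have e : germ (M ⊗ Y) U x hx s = germ (M ⊗ Y) U x hx t := by
    rw [← hΨ s, ← hΨ t]
    exact congrArg Ψ hst
  obtain ⟨W, hW, i, hi⟩ := exists_res_eq (M ⊗ Y) hx e
  exact ⟨W, homOfLE i, hi, hW⟩

end

/-! ### Sheafification of presheaves of modules -/

lemma preservesFiniteColimits_tensorRight {C : Type u} [Category.{u} C]
    {R : Cᵒᵖ ⥤ CommRingCat.{u}} (F : PresheafOfModules.{u} (R ⋙ forget₂ _ _)) :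
    PreservesFiniteColimits (tensorRight F) :=
  PreservesColimitsOfSize.preservesFiniteColimits.{u, u} _

section

variable {X : Scheme.{u}}

/-- The adjunction between sheafification and the inclusion of sheaves into presheaves. -/
def sheafificationAdj (X : Scheme.{u}) :
    sheafification X ⊣ Scheme.Modules.toPresheafOfModules X :=
  PresheafOfModules.sheafificationAdjunction (𝟙 X.ringCatSheaf.obj)

instance : (sheafification X).IsLeftAdjoint := (sheafificationAdj X).isLeftAdjoint

instance : PreservesFiniteLimits (sheafification X) :=
  inferInstanceAs (PreservesFiniteLimits
    (PresheafOfModules.sheafification (𝟙 X.ringCatSheaf.obj)))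

instance : (sheafification X).Additive :=
  Functor.additive_of_preserves_binary_products _

instance : IsIso (sheafificationAdj X).counit :=
  inferInstanceAs (IsIso (PresheafOfModules.sheafificationAdjunction (𝟙 X.ringCatSheaf.obj)).counit)

instance (Y : X.PresheafOfModules) : PreservesFiniteColimits (presheafTensor Y) :=
  preservesFiniteColimits_tensorRight (R := X.presheaf) Y

instance (Y : X.PresheafOfModules) : (presheafTensor Y).Additive where
  map_add := by
    intro A B f g
    ext U : 1
    exact MonoidalPreadditive.add_whiskerRight (C := ModuleCat (X.presheaf.obj U)) ..

instance : (Scheme.Modules.toPresheafOfModules X).Additive where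

lemma mono_sheafification_map {A B : X.PresheafOfModules} (f : A ⟶ B)
    [Presheaf.IsLocallyInjective (Opens.grothendieckTopology X)
      ((PresheafOfModules.toPresheaf _).map f)] : Mono ((sheafification X).map f) := by
  have : Mono ((presheafToSheaf (Opens.grothendieckTopology X) AddCommGrpCat.{u}).map
      ((PresheafOfModules.toPresheaf _).map f)) := by
    have := (Presheaf.isLocallyInjective_presheafToSheaf_map_iff (Opens.grothendieckTopology X)
      ((PresheafOfModules.toPresheaf _).map f)).mpr inferInstance
    exact Sheaf.mono_of_isLocallyInjective _
  exact (SheafOfModules.toSheaf X.ringCatSheaf).mono_of_mono_map this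

lemma isIso_sheafification_map {A B : X.PresheafOfModules} (f : A ⟶ B)
    [Presheaf.IsLocallyInjective (Opens.grothendieckTopology X)
      ((PresheafOfModules.toPresheaf _).map f)]
    [Presheaf.IsLocallySurjective (Opens.grothendieckTopology X)
      ((PresheafOfModules.toPresheaf _).map f)] : IsIso ((sheafification X).map f) := by
  have : IsIso ((presheafToSheaf (Opens.grothendieckTopology X) AddCommGrpCat.{u}).map
      ((PresheafOfModules.toPresheaf _).map f)) :=
    (GrothendieckTopology.W_iff _ _).mp
      (GrothendieckTopology.W_of_isLocallyBijective (Opens.grothendieckTopology X)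
      ((PresheafOfModules.toPresheaf _).map f))
  have h : IsIso ((Scheme.Modules.toPresheaf X).map ((sheafification X).map f)) :=
    inferInstanceAs (IsIso ((sheafToPresheaf _ _).map ((presheafToSheaf
      (Opens.grothendieckTopology X) AddCommGrpCat.{u}).map
        ((PresheafOfModules.toPresheaf _).map f))))
  exact isIso_of_reflects_iso ((sheafification X).map f) (Scheme.Modules.toPresheaf X)

/-- Exactness of presheaves of modules is checked on sections, since evaluation at an open set
commutes with homology. -/
lemma presheaf_exact_of_app {S : ShortComplex X.PresheafOfModules}
    (h : ∀ U, (S.map (PresheafOfModules.evaluation _ U)).Exact) : S.Exact := by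
  rw [ShortComplex.exact_iff_isZero_homology, IsZero.iff_id_eq_zero]
  ext U : 1
  have := (S.map (PresheafOfModules.evaluation _ U)).exact_iff_isZero_homology.mp (h U)
  have e := this.of_iso (S.mapHomologyIso (PresheafOfModules.evaluation _ U)).symm
  exact e.eq_of_src _ _

end

/-! ### Tensoring locally bijective maps, and g-pure exact sequences -/

section

variable {T : TopCat.{u}} {R : T.Presheaf CommRingCat.{u}}
  {M M' : PresheafOfModules.{u} (R ⋙ forget₂ _ _)} (f : M ⟶ M')
  (Y : PresheafOfModules.{u} (R ⋙ forget₂ _ _))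

/-- The map on stalks induced by a morphism of presheaves of modules. -/
def stalkMap (x : T) : Stalk M x →+ Stalk M' x :=
  ((TopCat.Presheaf.stalkFunctor Ab.{u} x).map ((PresheafOfModules.toPresheaf _).map f)).hom

lemma stalkMap_germ (U : Opens T) (x : T) (hx : x ∈ U) (m : M.obj (op U)) :
    stalkMap f x (germ M U x hx m) = germ M' U x hx (f.app (op U) m) :=
  TopCat.Presheaf.stalkFunctor_map_germ_apply U x hx ((PresheafOfModules.toPresheaf _).map f) m

lemma app_res {U V : Opens T} (h : V ≤ U) (m : M.obj (op U)) :
    f.app (op V) (res M h m) = res M' h (f.app (op U) m) :=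
  PresheafOfModules.naturality_apply f (homOfLE h).op m

lemma app_smul (U : Opens T) (r : R.obj (op U)) (m : M.obj (op U)) :
    f.app (op U) (r • m) = r • f.app (op U) m :=
  (f.app (op U)).hom.map_smul r m

lemma stalkMap_bijective (x : T) (hi : Presheaf.IsLocallyInjective (Opens.grothendieckTopology T)
      ((PresheafOfModules.toPresheaf _).map f))
    (hs : Presheaf.IsLocallySurjective (Opens.grothendieckTopology T)
      ((PresheafOfModules.toPresheaf _).map f)) : Function.Bijective (stalkMap f x) := by
  constructor
  · rw [injective_iff_map_eq_zero]
    intro t ht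
    obtain ⟨U, hU, -, m, rfl⟩ := exists_germ_eq M (U := ⊤) (x := x) trivial t
    rw [stalkMap_germ, ← map_zero (germ M' U x hU)] at ht
    obtain ⟨V, hV, hVU, h⟩ := exists_res_eq M' hU ht
    rw [← app_res, map_zero] at h
    obtain ⟨W, i, hi, hW⟩ := Presheaf.equalizerSieve_mem (Opens.grothendieckTopology T)
      ((PresheafOfModules.toPresheaf _).map f) (X := op V) (res M hVU m) (0 : M.obj (op V))
      (h.trans (map_zero (f.app (op V)).hom).symm) x hV
    have hi : res M i.le (res M hVU m) = res M i.le 0 := hi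
    rw [← germ_res M hVU x hV, ← germ_res M i.le x hW, hi, map_zero, map_zero]
  · intro t
    obtain ⟨U, hU, -, m, rfl⟩ := exists_germ_eq M' (U := ⊤) (x := x) trivial t
    obtain ⟨V, i, ⟨m', hm'⟩, hV⟩ := Presheaf.imageSieve_mem (Opens.grothendieckTopology T)
      ((PresheafOfModules.toPresheaf _).map f) (U := op U) m x hU
    change M.obj (op V) at m'
    replace hm' : f.app (op V) m' = res M' i.le m := hm'
    exact ⟨germ M V x hV m', by rw [stalkMap_germ, hm', germ_res]⟩

lemma isLocallyInjective_whiskerRight_of_bijective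
    (hi : Presheaf.IsLocallyInjective (Opens.grothendieckTopology T)
      ((PresheafOfModules.toPresheaf _).map f))
    (hs : Presheaf.IsLocallySurjective (Opens.grothendieckTopology T)
      ((PresheafOfModules.toPresheaf _).map f)) :
    Presheaf.IsLocallyInjective (Opens.grothendieckTopology T)
      ((PresheafOfModules.toPresheaf _).map (f ▷ Y)) := by
  refine isLocallyInjective_whiskerRight Y f fun U x hx => ?_
  -- The factorization of the germ map is `M'(U) → M'_x ≃ M_x`.
  let e := AddEquiv.ofBijective (stalkMap f x) (stalkMap_bijective f x hi hs)
  refine ⟨(e.symm : Stalk M' x →+ Stalk M x).comp (germ M' U x hx), fun r m => ?_, fun m => ?_⟩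
  · obtain ⟨n, hn⟩ := (stalkMap_bijective f x hi hs).2 (germ M' U x hx m)
    have hn' : e.symm (germ M' U x hx m) = n := e.symm_apply_eq.mpr hn.symm
    change e.symm (germ M' U x hx (r • m)) = R.germ U x hx r • e.symm (germ M' U x hx m)
    rw [hn', AddEquiv.symm_apply_eq]
    obtain ⟨V, hV, h, n, rfl⟩ := exists_germ_eq M hx n
    change _ = stalkMap f x _
    rw [← TopCat.Presheaf.germ_res_apply R (homOfLE h) x hV r, ← germ_smul, stalkMap_germ,
      app_smul, germ_smul, germ_smul, ← stalkMap_germ, hn, TopCat.Presheaf.germ_res_apply]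
  · exact e.symm_apply_eq.mpr (stalkMap_germ f U x hx m).symm

lemma isLocallySurjective_whiskerRight
    (hs : Presheaf.IsLocallySurjective (Opens.grothendieckTopology T)
      ((PresheafOfModules.toPresheaf _).map f)) :
    Presheaf.IsLocallySurjective (Opens.grothendieckTopology T)
      ((PresheafOfModules.toPresheaf _).map (f ▷ Y)) := by
  constructor
  intro U t x hx
  suffices H : ∃ (V : Opens T) (h : V ≤ U) (_ : x ∈ V)
      (s : (M ⊗ Y : PresheafOfModules.{u} (R ⋙ forget₂ _ _)).obj (op V)),
      (f ▷ Y).app (op V) s = res (M' ⊗ Y) h t by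
    obtain ⟨V, h, hV, s, hs⟩ := H
    exact ⟨V, homOfLE h, ⟨s, hs⟩, hV⟩
  refine TensorProduct.induction_on (R := R.obj (op U)) (M := M'.obj (op U))
    (N := Y.obj (op U)) (motive := fun t => ∃ (V : Opens T) (h : V ≤ U) (_ : x ∈ V)
      (s : (M ⊗ Y : PresheafOfModules.{u} (R ⋙ forget₂ _ _)).obj (op V)),
      (f ▷ Y).app (op V) s = res (M' ⊗ Y) h t) t ?_ (fun m y => ?_) fun a b ha hb => ?_
  · exact ⟨U, le_rfl, hx, 0, (map_zero ((f ▷ Y).app (op U)).hom).trans (map_zero (res _ _)).symm⟩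
  · obtain ⟨V, i, ⟨m', hm'⟩, hV⟩ := Presheaf.imageSieve_mem (Opens.grothendieckTopology T)
      ((PresheafOfModules.toPresheaf _).map f) (U := op U) m x hx
    have hm' : f.app (op V) m' = res M' i.le m := hm'
    refine ⟨V, i.le, hV, tmul M Y V m' (res Y i.le y), ?_⟩
    change tmul M' Y V (f.app (op V) m') (res Y i.le y) = res (M' ⊗ Y) i.le (tmul M' Y U m y)
    rw [hm', res_tmul]
  · obtain ⟨V, h, hV, s, hs⟩ := ha
    obtain ⟨V', h', hV', s', hs'⟩ := hb
    refine ⟨V ⊓ V', inf_le_left.trans h, ⟨hV, hV'⟩,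
      res (M ⊗ Y) inf_le_left s + res (M ⊗ Y) inf_le_right s', ?_⟩
    refine (map_add ((f ▷ Y).app (op (V ⊓ V'))).hom _ _).trans ?_
    refine Eq.trans ?_ (map_add (res (M' ⊗ Y) _) _ _).symm
    refine congrArg₂ _ ?_ ?_
    · exact (app_res (f ▷ Y) inf_le_left s).trans ((congrArg _ hs).trans (res_res ..))
    · exact (app_res (f ▷ Y) inf_le_right s').trans ((congrArg _ hs').trans (res_res ..))

end

section

variable {X : Scheme.{u}}

/-- A short exact sequence of presheaves of modules remains short exact after tensoring with `Y`
and sheafifying as soon as its first map stays locally injective after tensoring. -/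
lemma shortExact_map_presheafTensor_sheafification {S : ShortComplex X.PresheafOfModules}
    (hS : S.ShortExact) (Y : X.PresheafOfModules)
    (h : Presheaf.IsLocallyInjective (Opens.grothendieckTopology X)
      ((PresheafOfModules.toPresheaf _).map ((presheafTensor Y).map S.f))) :
    (S.map (presheafTensor Y ⋙ sheafification X)).ShortExact := by
  have key : PreservesFiniteColimits (presheafTensor Y) ↔ ∀ S : ShortComplex X.PresheafOfModules,
      S.ShortExact → (S.map (presheafTensor Y)).Exact ∧ Epi ((presheafTensor Y).map S.g) :=
    (Functor.preservesFiniteColimits_tfae (presheafTensor Y)).out 3 0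
  have h := key.mp inferInstance S hS
  have := h.2
  exact
    { exact := h.1.map (sheafification X)
      mono_f := mono_sheafification_map ((presheafTensor Y).map S.f)
      epi_g := inferInstanceAs (Epi ((sheafification X).map ((presheafTensor Y).map S.g))) }

/-- Every sheaf is the sheafification of its underlying presheaf, so a short complex of sheaves is
short exact as soon as the sheafification of the underlying complex of presheaves is. -/
lemma shortExact_of_map_toPresheafOfModules {S : ShortComplex X.Modules}
    (hS : ((S.map (Scheme.Modules.toPresheafOfModules X)).map (sheafification X)).ShortExact) :
    S.ShortExact :=
  ShortComplex.shortExact_of_iso (S.mapNatIso (asIso (sheafificationAdj X).counit)) hS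

/-- A short complex of sheaves of modules is g-pure exact if it comes, up to a locally bijective
map in the third term, from a short exact sequence of presheaves whose first map stays locally
injective after tensoring. -/
lemma isGPureExact_of_presheaf {S : ShortComplex X.Modules} {T : ShortComplex X.PresheafOfModules}
    (hT : T.ShortExact) (φ : T ⟶ S.map (Scheme.Modules.toPresheafOfModules X))
    [IsIso φ.τ₁] [IsIso φ.τ₂]
    [Presheaf.IsLocallyInjective (Opens.grothendieckTopology X)
      ((PresheafOfModules.toPresheaf _).map φ.τ₃)]
    [Presheaf.IsLocallySurjective (Opens.grothendieckTopology X)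
      ((PresheafOfModules.toPresheaf _).map φ.τ₃)]
    (h : ∀ Y : X.PresheafOfModules, Presheaf.IsLocallyInjective (Opens.grothendieckTopology X)
      ((PresheafOfModules.toPresheaf _).map ((presheafTensor Y).map T.f))) :
    IsGPureExact S where
  shortExact := by
    apply shortExact_of_map_toPresheafOfModules
    let ψ := (sheafification X).mapShortComplex.map φ
    have : IsIso ψ.τ₁ := inferInstanceAs (IsIso ((sheafification X).map φ.τ₁))
    have : IsIso ψ.τ₂ := inferInstanceAs (IsIso ((sheafification X).map φ.τ₂))
    have : IsIso ψ.τ₃ := isIso_sheafification_map φ.τ₃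
    have : IsIso ψ := ShortComplex.isIso_of_isIso _
    exact ShortComplex.shortExact_of_iso (@asIso _ _ _ _ ψ this)
      (hT.map_of_exact (sheafification X))
  tensor Y := by
    let Y' := (Scheme.Modules.toPresheafOfModules X).obj Y
    let ψ := (presheafTensor Y' ⋙ sheafification X).mapShortComplex.map φ
    have : IsIso ψ.τ₁ := inferInstanceAs (IsIso ((presheafTensor Y' ⋙ sheafification X).map φ.τ₁))
    have : IsIso ψ.τ₂ := inferInstanceAs (IsIso ((presheafTensor Y' ⋙ sheafification X).map φ.τ₂))
    have : IsIso ψ.τ₃ := by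
      have h₁ := isLocallyInjective_whiskerRight_of_bijective (R := X.presheaf) φ.τ₃ Y' ‹_› ‹_›
      have h₂ := isLocallySurjective_whiskerRight (R := X.presheaf) φ.τ₃ Y' ‹_›
      exact @isIso_sheafification_map _ _ _ ((presheafTensor Y').map φ.τ₃) h₁ h₂
    have : IsIso ψ := ShortComplex.isIso_of_isIso _
    exact ShortComplex.shortExact_of_iso (@asIso _ _ _ _ ψ this)
      (shortExact_map_presheafTensor_sheafification hT Y' (h Y'))

/-- The cokernel sequence of a monomorphism of sheaves of modules, given by the sheafification of
the presheaf cokernel, is g-pure exact if the monomorphism stays locally injective after tensoring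
presheaves. -/
lemma exists_isGPureExact {A B : X.Modules} (f : A ⟶ B) [Mono f]
    (h : ∀ Y : X.PresheafOfModules, Presheaf.IsLocallyInjective (Opens.grothendieckTopology X)
      ((PresheafOfModules.toPresheaf _).map
        ((presheafTensor Y).map ((Scheme.Modules.toPresheafOfModules X).map f)))) :
    ∃ (C : X.Modules) (g : B ⟶ C) (w : f ≫ g = 0), IsGPureExact (ShortComplex.mk f g w) := by
  let F := Scheme.Modules.toPresheafOfModules X
  let π := cokernel.π (F.map f)
  let u := (sheafificationAdj X).unit.app (cokernel (F.map f))
  let g : B ⟶ (sheafification X).obj (cokernel (F.map f)) := F.preimage (π ≫ u)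
  have hg : F.map g = π ≫ u := F.map_preimage _
  have w : f ≫ g = 0 := F.map_injective (by
    rw [F.map_comp, hg, cokernel.condition_assoc, zero_comp, F.map_zero])
  refine ⟨_, g, w, ?_⟩
  let φ : ShortComplex.mk (F.map f) π (cokernel.condition _) ⟶ (ShortComplex.mk f g w).map F :=
    { τ₁ := 𝟙 _
      τ₂ := 𝟙 _
      τ₃ := u
      comm₁₂ := (Category.id_comp _).trans (Category.comp_id _).symm
      comm₂₃ := (Category.id_comp _).trans hg }
  have : IsIso φ.τ₁ := inferInstanceAs (IsIso (𝟙 _))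
  have : IsIso φ.τ₂ := inferInstanceAs (IsIso (𝟙 _))
  have : Presheaf.IsLocallyInjective (Opens.grothendieckTopology X)
      ((PresheafOfModules.toPresheaf _).map φ.τ₃) :=
    inferInstanceAs (Presheaf.IsLocallyInjective (Opens.grothendieckTopology X)
      (CategoryTheory.toSheafify _ _))
  have : Presheaf.IsLocallySurjective (Opens.grothendieckTopology X)
      ((PresheafOfModules.toPresheaf _).map φ.τ₃) :=
    inferInstanceAs (Presheaf.IsLocallySurjective (Opens.grothendieckTopology X)
      (CategoryTheory.toSheafify _ _))
  refine isGPureExact_of_presheaf ?_ φ h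
  exact { exact := ShortComplex.exact_cokernel _
          mono_f := inferInstanceAs (Mono (F.map f))
          epi_g := inferInstanceAs (Epi (cokernel.π _)) }

end

/-! ### Products of skyscrapers -/

section

variable {X : Scheme.{u}}

/-- The presheaf of modules underlying a sheaf of modules, over the presheaf of commutative rings
`𝒪_X`. -/
def pre (A : X.Modules) : PresheafOfModules.{u} (X.presheaf ⋙ forget₂ CommRingCat RingCat) :=
  A.val

/-- The sections over `U` of a sheaf of modules. -/
abbrev Sec (A : X.Modules) (U : X.Opens) : Type u := (pre A).obj (op U)

/-- The restriction of sections of a sheaf of modules. -/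
abbrev rest (A : X.Modules) {U V : X.Opens} (h : V ≤ U) : Sec A U →+ Sec A V :=
  res (pre A) h

/-- The action of a morphism of sheaves of modules on sections. -/
def onSec {A B : X.Modules} (f : A ⟶ B) (U : X.Opens) : Sec A U →ₗ[Γ(X, U)] Sec B U :=
  (f.val.app (op U)).hom

lemma onSec_rest {A B : X.Modules} (f : A ⟶ B) {U V : X.Opens} (h : V ≤ U) (s : Sec A U) :
    onSec f V (rest A h s) = rest B h (onSec f U s) :=
  app_res (R := X.presheaf) f.val h s

lemma hom_ext_onSec {A B : X.Modules} {f g : A ⟶ B} (h : ∀ U s, onSec f U s = onSec g U s) :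
    f = g := by
  apply SheafOfModules.hom_ext
  ext U s
  exact h U.unop s

/-- A morphism of sheaves of modules from its action on sections. -/
def homOfSec {A B : X.Modules} (φ : ∀ U : X.Opens, Sec A U →+ Sec B U)
    (hs : ∀ (U : X.Opens) (r : Γ(X, U)) (s : Sec A U), φ U (r • s) = r • φ U s)
    (hr : ∀ (U V : X.Opens) (h : V ≤ U) (s : Sec A U), φ V (rest A h s) = rest B h (φ U s)) :
    A ⟶ B :=
  SheafOfModules.Hom.mk <| PresheafOfModules.homMk
    { app U := AddCommGrpCat.ofHom (φ U.unop)
      naturality U V i := by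
        ext s
        exact hr U.unop V.unop (leOfHom i.unop) s }
    (fun U r s => hs U.unop r s)

lemma isIso_of_bijective {A B : X.Modules} (f : A ⟶ B)
    (h : ∀ U, Function.Bijective (onSec f U)) : IsIso f := by
  rw [Scheme.Modules.Hom.isIso_iff_isIso_app]
  intro U
  rw [ConcreteCategory.isIso_iff_bijective]
  exact h U

lemma isZero_iff_subsingleton (A : X.Modules) : IsZero A ↔ ∀ U, Subsingleton (Sec A U) := by
  constructor
  · intro h U
    have e := h.eq_of_src (𝟙 A) 0
    refine ⟨fun s t => ?_⟩
    have h₁ (s : Sec A U) : s = 0 := congr(onSec $e U s)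
    rw [h₁ s, h₁ t]
  · intro h
    rw [IsZero.iff_id_eq_zero]
    exact hom_ext_onSec fun U s => Subsingleton.elim _ _

/-- Sections of a sheaf of modules with the same germs are equal. -/
lemma eq_of_germ_eq (A : X.Modules) {U : X.Opens} {s t : Sec A U}
    (h : ∀ x hx, germ (pre A) U x hx s = germ (pre A) U x hx t) :
    s = t :=
  TopCat.Presheaf.section_ext ⟨A.presheaf, A.isSheaf⟩ U s t h

section Godement

variable (M : ∀ x : X, ModuleCat.{u} (X.presheaf.stalk x))

/-- The sections over `U` of the product of the skyscrapers with values `M x`: families of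
elements of `M x` for `x ∈ U`. -/
abbrev GodementSections (U : X.Opens) : Type u := ∀ x : U, M x

instance godementModule (U : X.Opens) : Module Γ(X, U) (GodementSections M U) where
  smul r s x := X.presheaf.germ U x.1 x.2 r • s x
  one_smul s := funext fun x => by
    change X.presheaf.germ U x.1 x.2 1 • s x = s x
    rw [map_one, one_smul]
  mul_smul r r' s := funext fun x => by
    change X.presheaf.germ U x.1 x.2 (r * r') • s x =
      X.presheaf.germ U x.1 x.2 r • X.presheaf.germ U x.1 x.2 r' • s x
    rw [map_mul, mul_smul]
  smul_zero r := funext fun x => smul_zero (X.presheaf.germ U x.1 x.2 r)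
  smul_add r s s' := funext fun x => smul_add (X.presheaf.germ U x.1 x.2 r) (s x) (s' x)
  add_smul r r' s := funext fun x => by
    change X.presheaf.germ U x.1 x.2 (r + r') • s x =
      X.presheaf.germ U x.1 x.2 r • s x + X.presheaf.germ U x.1 x.2 r' • s x
    rw [map_add, add_smul]
  zero_smul s := funext fun x => by
    change X.presheaf.germ U x.1 x.2 0 • s x = 0
    rw [map_zero, zero_smul]

/-- The underlying presheaf of abelian groups of the product of skyscrapers. -/
def godementAb : TopCat.Presheaf Ab.{u} X where
  obj U := AddCommGrpCat.of (GodementSections M U.unop)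
  map {U V} i := AddCommGrpCat.ofHom
    { toFun := fun s x => s ⟨x.1, i.unop.le x.2⟩
      map_zero' := rfl
      map_add' := fun _ _ => rfl }

/-- The product of skyscrapers as a presheaf of modules. -/
def godementPresheafOfModules : X.PresheafOfModules :=
  letI (U : (Opens X)ᵒᵖ) : Module (X.ringCatSheaf.obj.obj U) ((godementAb M).obj U) :=
    godementModule M U.unop
  PresheafOfModules.ofPresheaf (godementAb M) (by
    intro U V i r m
    funext x
    change X.presheaf.germ U.unop x.1 (i.unop.le x.2) r • m ⟨x.1, i.unop.le x.2⟩ =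
      X.presheaf.germ V.unop x.1 x.2 (X.presheaf.map i r) • m ⟨x.1, i.unop.le x.2⟩
    rw [← TopCat.Presheaf.germ_res_apply X.presheaf i.unop x.1 x.2 r]
    rfl)

theorem godement_isSheaf : (godementAb M).IsSheaf := by
  rw [TopCat.Presheaf.isSheaf_iff_isSheaf_comp (forget Ab.{u})]
  apply TopCat.Presheaf.isSheaf_of_isSheafUniqueGluing_types
  intro ι U sf hsf
  have key : ∀ i j (x : X) (hi : x ∈ U i) (hj : x ∈ U j), sf i ⟨x, hi⟩ = sf j ⟨x, hj⟩ :=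
    fun i j x hi hj => congrFun (hsf i j) ⟨x, ⟨hi, hj⟩⟩
  refine ⟨fun x => sf (Opens.mem_iSup.mp x.2).choose ⟨x.1, (Opens.mem_iSup.mp x.2).choose_spec⟩,
    fun i => funext fun x => key _ _ _ _ x.2, fun s hs => funext fun x => ?_⟩
  exact congrFun (hs (Opens.mem_iSup.mp x.2).choose) ⟨x.1, (Opens.mem_iSup.mp x.2).choose_spec⟩

/-- The product over all points `x` of the skyscrapers with values `M x`, as a sheaf of modules. -/
def godement : X.Modules :=
  SheafOfModules.mk (godementPresheafOfModules M) (godement_isSheaf M)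

open scoped Classical in
/-- The endomorphism of the product of skyscrapers that replaces the components at the points of
`U` by zero. -/
def killOn (U : X.Opens) : godement M ⟶ godement M :=
  homOfSec (A := godement M) (B := godement M)
    (fun W =>
      { toFun := fun (s : GodementSections M W) =>
          ((fun x => if x.1 ∈ U then 0 else s x) : GodementSections M W)
        map_zero' := funext fun x => ite_self _
        map_add' := fun s t => funext fun x => by
          change (if x.1 ∈ U then 0 else s x + t x) =
            (if x.1 ∈ U then 0 else s x) + (if x.1 ∈ U then 0 else t x)
          split_ifs <;> simp })
    (fun W r s => funext fun x => by
      change (if x.1 ∈ U then 0 else X.presheaf.germ W x.1 x.2 r • s x) =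
        X.presheaf.germ W x.1 x.2 r • (if x.1 ∈ U then 0 else s x)
      split_ifs <;> simp)
    (fun _ _ _ _ => rfl)

lemma onSec_killOn_of_mem (U W : X.Opens) (s : GodementSections M W) (x : W) (hx : x.1 ∈ U) :
    (onSec (killOn M U) W s : GodementSections M W) x = 0 :=
  if_pos hx

lemma onSec_killOn_of_notMem (U W : X.Opens) (s : GodementSections M W) (x : W) (hx : x.1 ∉ U) :
    (onSec (killOn M U) W s : GodementSections M W) x = s x :=
  if_neg hx

end Godement

/-- The stalk of a sheaf of modules as a module over the local ring. -/
def stalkModule (A : X.Modules) (x : X) : ModuleCat.{u} (X.presheaf.stalk x) :=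
  ModuleCat.of _ (Stalk (pre A) x)

/-- The embedding of a sheaf of modules into the product of the skyscrapers of its stalks. -/
def toGodement (A : X.Modules) : A ⟶ godement (stalkModule A) :=
  homOfSec (B := godement (stalkModule A))
    (fun W =>
      { toFun := fun s => ((fun x => germ (pre A) W x.1 x.2 s) :
          GodementSections (stalkModule A) W)
        map_zero' := funext fun _ => map_zero _
        map_add' := fun s t => funext fun _ => map_add _ s t })
    (fun W r s => funext fun x => germ_smul (pre A) W x.1 x.2 r s)
    (fun _ _ h s => funext fun x => germ_res (pre A) h x.1 x.2 s)

lemma onSec_toGodement (A : X.Modules) (W : X.Opens) (s : Sec A W) (x : W) :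
    (onSec (toGodement A) W s : GodementSections (stalkModule A) W) x =
      germ (pre A) W x.1 x.2 s := rfl

instance (A : X.Modules) : Mono (toGodement A) := by
  refine ⟨fun f g h => hom_ext_onSec fun U s => eq_of_germ_eq A fun x hx => ?_⟩
  have e : onSec (toGodement A) U (onSec f U s) = onSec (toGodement A) U (onSec g U s) :=
    congr(onSec $h U s)
  exact congrFun (e : (_ : GodementSections (stalkModule A) U) = _) ⟨x, hx⟩

/-- The projection of the product of skyscrapers to the factor at `x` provides the factorization of
the germ map at `x` that local injectivity of the tensored map requires. -/
lemma toGodement_isLocallyInjective (A : X.Modules) (Y : X.PresheafOfModules) :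
    Presheaf.IsLocallyInjective (Opens.grothendieckTopology X)
      ((PresheafOfModules.toPresheaf _).map
        ((presheafTensor Y).map ((Scheme.Modules.toPresheafOfModules X).map (toGodement A)))) := by
  refine isLocallyInjective_whiskerRight (R := X.presheaf) Y
    ((Scheme.Modules.toPresheafOfModules X).map (toGodement A)) fun U x hx => ?_
  refine ⟨{ toFun := fun (s : GodementSections (stalkModule A) U) => s ⟨x, hx⟩
            map_zero' := rfl
            map_add' := fun _ _ => rfl }, fun r m => rfl, fun m => rfl⟩

/-- A g-pure-injective sheaf of modules is a direct summand of the product of the skyscrapers of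
its stalks. -/
lemma IsGPureInjective.exists_retraction {A : X.Modules} (hA : IsGPureInjective A) :
    ∃ r : godement (stalkModule A) ⟶ A, toGodement A ≫ r = 𝟙 A := by
  obtain ⟨C, g, w, hS⟩ := exists_isGPureExact (toGodement A) (toGodement_isLocallyInjective A)
  have := (hA _ hS).epi_g
  obtain ⟨r, hr⟩ := (AddCommGrpCat.epi_iff_surjective _).mp this (𝟙 A)
  exact ⟨r, hr⟩

end

/-! ### Indecomposable summands of products of skyscrapers -/

section

/-- An idempotent `e` splits `A` as the biproduct of the images of `e` and of `1 - e`. -/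
lemma eq_zero_or_eq_id_of_indecomposable {C : Type*} [Category* C] [Abelian C] {A : C}
    (hA : Indecomposable A) (e : A ⟶ A) (he : e ≫ e = e) : e = 0 ∨ e = 𝟙 A := by
  obtain ⟨Y, i, p, hip, hpi⟩ := IsIdempotentComplete.idempotents_split A e he
  obtain ⟨Z, j, q, hjq, hqj⟩ := IsIdempotentComplete.idempotents_split A (𝟙 A - e)
    (Idempotents.idem_of_id_sub_idem e he)
  have hiq : i ≫ q = 0 := by
    have : i ≫ (q ≫ j) = 0 := by
      rw [hqj, ← hpi, Preadditive.comp_sub, reassoc_of% hip]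
      simp
    simpa [hjq] using this =≫ q
  have hjp : j ≫ p = 0 := by
    have : j ≫ (p ≫ i) = 0 := by
      have h : p ≫ i = 𝟙 A - q ≫ j := by rw [hpi, hqj]; abel
      rw [h, Preadditive.comp_sub, reassoc_of% hjq]
      simp
    simpa [hip] using this =≫ p
  let iso : A ≅ Y ⊞ Z :=
    { hom := biprod.lift p q
      inv := biprod.desc i j
      hom_inv_id := by rw [biprod.lift_desc, hpi, hqj]; abel
      inv_hom_id := by ext <;> simp [hip, hjq, hiq, hjp] }
  rcases hA.2 Y Z iso with h | h
  · left
    rw [← hpi, h.eq_of_tgt p 0, zero_comp]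
  · right
    have : 𝟙 A - e = 0 := by rw [← hqj, h.eq_of_tgt q 0, zero_comp]
    exact (sub_eq_zero.mp this).symm

variable {X : Scheme.{u}} {A : X.Modules}

lemma onSec_comp {A B C : X.Modules} (f : A ⟶ B) (g : B ⟶ C) (U : X.Opens) (s : Sec A U) :
    onSec (f ≫ g) U s = onSec g U (onSec f U s) := rfl

/-- For a direct summand `A` of a product of skyscrapers, the subsheaf of sections supported outside
an open set `U` is a direct summand of `A`. If `A` is indecomposable, this summand is either
everything or zero. -/
lemma subsingleton_or_bijective_of_retraction (hA : Indecomposable A)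
    (r : godement (stalkModule A) ⟶ A) (hr : toGodement A ≫ r = 𝟙 A) (U : X.Opens) :
    Subsingleton (Sec A U) ∨
      ∀ W : X.Opens, Function.Bijective (rest A (inf_le_left : W ⊓ U ≤ W)) := by
  have hr' (W : X.Opens) (s : Sec A W) : onSec r W (onSec (toGodement A) W s) = s :=
    congr(onSec $hr W s)
  -- `e` takes values in the sections that vanish on `U` and fixes these sections, so it is
  -- idempotent.
  let e : A ⟶ A := toGodement A ≫ killOn _ U ≫ r
  have he_res (W : X.Opens) (s : Sec A W) : rest A (inf_le_left : W ⊓ U ≤ W) (onSec e W s) = 0 := by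
    simp only [e, onSec_comp]
    rw [← onSec_rest, ← onSec_rest]
    have h (t : Sec (godement (stalkModule A)) (W ⊓ U)) : onSec (killOn _ U) (W ⊓ U) t = 0 :=
      funext fun x : (W ⊓ U : X.Opens) => onSec_killOn_of_mem _ U (W ⊓ U) t x x.2.2
    rw [h, map_zero]
  have he_id (W : X.Opens) (s : Sec A W) (hs : rest A (inf_le_left : W ⊓ U ≤ W) s = 0) :
      onSec e W s = s := by
    have h : onSec (killOn _ U) W (onSec (toGodement A) W s) = onSec (toGodement A) W s := by
      refine funext fun x : W => ?_
      by_cases hx : x.1 ∈ U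
      · refine (onSec_killOn_of_mem _ U W _ x hx).trans ?_
        rw [onSec_toGodement, ← germ_res (pre A) inf_le_left x.1 ⟨x.2, hx⟩]
        exact ((congrArg _ hs).trans (map_zero _)).symm
      · exact onSec_killOn_of_notMem _ U W _ x hx
    simp only [e, onSec_comp]
    rw [h, hr']
  have hee : e ≫ e = e := hom_ext_onSec fun W s => he_id W _ (he_res W s)
  rcases eq_zero_or_eq_id_of_indecomposable hA e hee with h | h
  · right
    refine fun W => ⟨(injective_iff_map_eq_zero _).mpr fun s hs => ?_, fun t => ?_⟩
    · rw [← he_id W s hs, h]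
      rfl
    · classical
      -- Extend the image of `t` in the product of skyscrapers by zero, and retract to `A`.
      let p : GodementSections (stalkModule A) W := fun x =>
        if hx : x.1 ∈ U then
          (onSec (toGodement A) (W ⊓ U) t : GodementSections (stalkModule A) (W ⊓ U))
            ⟨x.1, x.2, hx⟩
        else 0
      have hp : rest (godement (stalkModule A)) (inf_le_left : W ⊓ U ≤ W) p =
          onSec (toGodement A) (W ⊓ U) t :=
        funext fun x : (W ⊓ U : X.Opens) => dif_pos x.2.2
      exact ⟨onSec r W p, (onSec_rest r inf_le_left p).symm.trans ((congrArg _ hp).trans (hr' _ t))⟩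
  · left
    have h0 (s : Sec A U) : s = 0 := by
      have h₁ := he_res U s
      rw [h] at h₁
      have h₂ : rest A (le_inf le_rfl le_rfl : U ≤ U ⊓ U) (rest A inf_le_left s) = s :=
        (res_res (pre A) ..).trans (res_self (pre A) s)
      rw [← h₂]
      exact (congrArg _ h₁).trans (map_zero _)
    exact ⟨fun s t => (h0 s).trans (h0 t).symm⟩

/-- If every restriction map of a non-zero sheaf `A` to an open set on which `A` does not vanish is
bijective, then the support of `A` is irreducible, and its generic point `x` satisfies: `A` vanishes
on the open sets that do not contain `x`, and the restriction maps between open sets containing `x`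
are bijective. -/
lemma exists_generic_point (hA : ¬ IsZero A)
    (h : ∀ U : X.Opens, Subsingleton (Sec A U) ∨
      ∀ W : X.Opens, Function.Bijective (rest A (inf_le_left : W ⊓ U ≤ W))) :
    ∃ x : X, (∀ U : X.Opens, x ∉ U → Subsingleton (Sec A U)) ∧
      ∀ (U V : X.Opens) (hVU : V ≤ U), x ∈ V → Function.Bijective (rest A hVU) := by
  -- The largest open set on which `A` vanishes.
  let U₀ : X.Opens := sSup {U | Subsingleton (Sec A U)}
  have mono {U V : X.Opens} (hVU : V ≤ U) (hU : Subsingleton (Sec A U)) :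
      Subsingleton (Sec A V) := by
    rcases h V with hV | hV
    · exact hV
    · have h₁ : Subsingleton (Sec A (U ⊓ V)) := (hV U).2.subsingleton
      rwa [inf_eq_right.mpr hVU] at h₁
  have h₀ {U : X.Opens} : Subsingleton (Sec A U) ↔ U ≤ U₀ := by
    refine ⟨fun hU => le_sSup hU, fun hU => ?_⟩
    have h0 (s : Sec A U) : s = 0 := eq_of_germ_eq A fun x hx => by
      obtain ⟨V, hV, hxV⟩ := Opens.mem_sSup.mp (hU hx)
      have : Subsingleton (Sec A (U ⊓ V)) := mono inf_le_right hV
      rw [← germ_res (pre A) (inf_le_left : U ⊓ V ≤ U) x ⟨hx, hxV⟩, map_zero,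
        Subsingleton.elim (res (pre A) (inf_le_left : U ⊓ V ≤ U) s) 0, map_zero]
    exact ⟨fun s t => (h0 s).trans (h0 t).symm⟩
  have hbij {U V : X.Opens} (hVU : V ≤ U) (hV : ¬ V ≤ U₀) : Function.Bijective (rest A hVU) := by
    have h₁ := ((h V).resolve_left (fun h' => hV (h₀.mp h'))) U
    have h₂ {W : X.Opens} (hW : W = V) (hWU : W ≤ U) (hb : Function.Bijective (rest A hWU)) :
        Function.Bijective (rest A hVU) := by
      subst hW
      exact hb
    exact h₂ (inf_eq_right.mpr hVU) _ h₁
  have hirr : IsIrreducible ((U₀ : Set X)ᶜ) := by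
    constructor
    · by_contra hne
      rw [Set.not_nonempty_iff_eq_empty, Set.compl_empty_iff] at hne
      exact hA ((isZero_iff_subsingleton A).mpr fun U => h₀.mpr fun x _ =>
        (Set.eq_univ_iff_forall.mp hne x :))
    · rintro U V hU hV ⟨x, hx, hxU⟩ ⟨y, hy, hyV⟩
      -- If `A` vanishes on `U ∩ V` but not on `V`, then the bijective restriction from `U` to
      -- `U ∩ V` shows that `A` vanishes on `U`.
      let U' : X.Opens := ⟨U, hU⟩
      let V' : X.Opens := ⟨V, hV⟩
      by_contra hne
      have hle : U' ⊓ V' ≤ U₀ := fun z hz => by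
        by_contra hz'
        exact hne ⟨z, hz', hz⟩
      have h₁ : Subsingleton (Sec A (U' ⊓ V')) := h₀.mpr hle
      have hV' : ¬ V' ≤ U₀ := fun h' => hy (h' hyV)
      have h₂ := ((h V').resolve_left (fun h' => hV' (h₀.mp h'))) U'
      have h₃ : Subsingleton (Sec A U') := h₂.1.subsingleton
      exact hx (h₀.mp h₃ hxU)
  obtain ⟨x, hx⟩ := QuasiSober.sober hirr U₀.2.isClosed_compl
  have hmem {U : X.Opens} : x ∈ U ↔ ¬ U ≤ U₀ := by
    refine (hx.mem_open_set_iff U.2).trans ?_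
    constructor
    · rintro ⟨y, hy, hyU⟩ h'
      exact hy (h' hyU)
    · intro h'
      obtain ⟨y, hyU, hy⟩ := Set.not_subset.mp h'
      exact ⟨y, hy, hyU⟩
  exact ⟨x, fun U hU => h₀.mpr (not_not.mp fun h' => hU (hmem.mpr h')),
    fun U V hVU hxV => hbij hVU (hmem.mp hxV)⟩

/-- The map from a sheaf of modules to the skyscraper of one of its stalks. -/
def toSkyscraper (A : X.Modules) (x : X) : A ⟶ skyscraper x (stalkModule A x) :=
  homOfSec (B := skyscraper x (stalkModule A x))
    (fun W =>
      { toFun := fun s => ((fun h => germ (pre A) W x h.down s) :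
          SkyscraperSections x (stalkModule A x) W)
        map_zero' := funext fun _ => map_zero _
        map_add' := fun s t => funext fun _ => map_add _ s t })
    (fun W r s => funext fun h => germ_smul (pre A) W x h.down r s)
    (fun _ _ i s => funext fun h => germ_res (pre A) i x h.down s)

lemma isIso_toSkyscraper (x : X) (h₀ : ∀ U : X.Opens, x ∉ U → Subsingleton (Sec A U))
    (h : ∀ (U V : X.Opens) (hVU : V ≤ U), x ∈ V → Function.Bijective (rest A hVU)) :
    IsIso (toSkyscraper A x) := by
  refine isIso_of_bijective _ fun U => ?_
  by_cases hx : x ∈ U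
  · constructor
    · intro s t hst
      have hst : germ (pre A) U x hx s = germ (pre A) U x hx t :=
        congrFun (hst : (_ : SkyscraperSections x (stalkModule A x) U) = _) ⟨hx⟩
      obtain ⟨V, hV, hVU, e⟩ := exists_res_eq (pre A) hx hst
      exact (h U V hVU hV).1 e
    · intro (t : SkyscraperSections x (stalkModule A x) U)
      obtain ⟨V, hV, hVU, m, hm⟩ := exists_germ_eq (pre A) hx (t ⟨hx⟩)
      obtain ⟨s, rfl⟩ := (h U V hVU hV).2 m
      refine ⟨s, funext fun (_ : PLift (x ∈ U)) => ?_⟩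
      exact (germ_res (pre A) hVU x hV s).symm.trans hm
  · have := h₀ U hx
    refine ⟨Function.injective_of_subsingleton _, fun (t : SkyscraperSections _ _ U) => ⟨0, ?_⟩⟩
    exact funext fun (h' : PLift (x ∈ U)) => absurd h'.down hx

end

/-! ### The skyscraper functor and purity -/

section

/-- A linear map over `S` that stays injective after tensoring over `S` stays injective after
tensoring over `R`, for a ring homomorphism `R → S`: indeed `A ⊗[R] Y = A ⊗[S] (S ⊗[R] Y)`. The
restrictions of scalars of `A` and `B` are given up to isomorphism, as `A'` and `B'`. -/
lemma rTensor_injective_of_restrictScalars {R S : Type u} [CommRing R] [CommRing S] (ρ : R →+* S)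
    {A B A' B' Y : Type u} [AddCommGroup A] [AddCommGroup B] [AddCommGroup A'] [AddCommGroup B']
    [AddCommGroup Y] [Module S A] [Module S B] [Module R A'] [Module R B'] [Module R Y]
    (f : A →ₗ[S] B) (g : A' →ₗ[R] B') (eA : A' ≃+ A) (hA : ∀ r a, eA (r • a) = ρ r • eA a)
    (eB : B' ≃+ B) (hB : ∀ r b, eB (r • b) = ρ r • eB b) (hfg : ∀ a, eB (g a) = f (eA a))
    (hf : ∀ (Z : Type u) [AddCommGroup Z] [Module S Z], Function.Injective (f.rTensor Z)) :
    Function.Injective (g.rTensor Y) := by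
  algebraize [ρ]
  let _ : Module R A := Module.compHom A ρ
  let _ : Module R B := Module.compHom B ρ
  have : IsScalarTower R S A := ⟨fun r s a => mul_smul (ρ r) s a⟩
  have : IsScalarTower R S B := ⟨fun r s a => mul_smul (ρ r) s a⟩
  let eA' : A' ≃ₗ[R] A := { eA with map_smul' := hA }
  let eB' : B' ≃ₗ[R] B := { eB with map_smul' := hB }
  let cA := TensorProduct.AlgebraTensorModule.cancelBaseChange R S S A Y
  let cB := TensorProduct.AlgebraTensorModule.cancelBaseChange R S S B Y
  have h₁ : Function.Injective ((f.restrictScalars R).rTensor Y) := by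
    have hc (z) : cB (f.rTensor _ z) = (f.restrictScalars R).rTensor Y (cA z) := by
      induction z with
      | zero => simp
      | add a b ha hb => simp only [map_add, ha, hb]
      | tmul a z =>
        induction z with
        | zero => simp
        | add a b ha hb => simp only [map_add, ha, hb, TensorProduct.tmul_add]
        | tmul s y => simp [cA, cB]
    intro z z' h
    obtain ⟨w, rfl⟩ := cA.surjective z
    obtain ⟨w', rfl⟩ := cA.surjective z'
    rw [← hc, ← hc] at h
    rw [hf _ (cB.injective h)]
  have h₂ : eB'.toLinearMap ∘ₗ g = f.restrictScalars R ∘ₗ eA'.toLinearMap :=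
    LinearMap.ext hfg
  have h₃ := congrArg (LinearMap.rTensor Y) h₂
  rw [LinearMap.rTensor_comp, LinearMap.rTensor_comp] at h₃
  have h₄ : Function.Injective (eB'.toLinearMap.rTensor Y ∘ₗ g.rTensor Y) := by
    rw [h₃]
    exact h₁.comp (eA'.rTensor Y).injective
  exact Function.Injective.of_comp h₄

variable {X : Scheme.{u}} (x : X)

/-- The skyscraper functor from modules over the local ring at `x` to sheaves of modules. -/
def skyscraperFunctor : ModuleCat.{u} (X.presheaf.stalk x) ⥤ X.Modules where
  obj := skyscraper x
  map {M N} f :=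
    homOfSec (A := skyscraper x M) (B := skyscraper x N)
      (fun W =>
        { toFun := fun s => ((fun h => f.hom ((s : SkyscraperSections x M W) h)) :
            SkyscraperSections x N W)
          map_zero' := funext fun _ => map_zero _
          map_add' := fun (s t : SkyscraperSections x M W) =>
            funext fun h => map_add f.hom (s h) (t h) })
      (fun W r (s : SkyscraperSections x M W) => funext fun h => f.hom.map_smul _ (s h))
      (fun _ _ _ _ => rfl)

instance : (skyscraperFunctor x).Additive where

instance : (skyscraperFunctor x).Faithful where
  map_injective {M N} f g h := by
    ext m
    have e : onSec ((skyscraperFunctor x).map f) ⊤ (fun _ => m : SkyscraperSections x M ⊤) =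
        onSec ((skyscraperFunctor x).map g) ⊤ (fun _ => m : SkyscraperSections x M ⊤) := by rw [h]
    exact congrFun (e : (_ : SkyscraperSections x N ⊤) = _) ⟨trivial⟩

instance : (skyscraperFunctor x).Full where
  map_surjective {M N} φ := by
    let g (m : M) : N :=
      (onSec φ ⊤ (fun _ => m : SkyscraperSections x M ⊤) : SkyscraperSections x N ⊤) ⟨trivial⟩
    -- Over every neighbourhood of `x` the morphism `φ` acts by the same map `g`. It is linear over
    -- the local ring, as it is linear over the sections of `𝒪_X` on each of these neighbourhoods.
    have key (U : X.Opens) (hx : x ∈ U) (s : SkyscraperSections x M U) :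
        (onSec φ U s : SkyscraperSections x N U) ⟨hx⟩ = g (s ⟨hx⟩) :=
      congrFun (onSec_rest φ (le_top : U ≤ ⊤)
        (fun _ => s ⟨hx⟩ : SkyscraperSections x M ⊤) : (_ : SkyscraperSections x N U) = _) ⟨hx⟩
    refine ⟨ModuleCat.ofHom (X := M) (Y := N)
      { toFun := g
        map_add' := fun m m' => congrFun ((onSec φ ⊤).map_add
          (fun _ => m : SkyscraperSections x M ⊤) (fun _ => m' : SkyscraperSections x M ⊤) :
            (_ : SkyscraperSections x N ⊤) = _) ⟨trivial⟩
        map_smul' := fun r m => ?_ }, ?_⟩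
    · obtain ⟨U, hx, r, rfl⟩ := X.presheaf.exists_germ_eq r
      have e : (_ : SkyscraperSections x N U) = _ :=
        (onSec φ U).map_smul r (fun _ => m : SkyscraperSections x M U)
      refine (key U hx (fun _ => X.presheaf.germ U x hx r • m)).symm.trans
        ((congrFun e ⟨hx⟩).trans ?_)
      exact congrArg (X.presheaf.germ U x hx r • ·) (key U hx (fun _ => m))
    · exact hom_ext_onSec fun U s => funext fun h : PLift (x ∈ U) => (key U h.down s).symm

/-- The skyscraper functor sends pure-exact sequences to g-pure exact sequences. It already does so
at the level of presheaves. -/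
lemma IsPureExact.skyscraper {S : ShortComplex (ModuleCat.{u} (X.presheaf.stalk x))}
    (hS : IsPureExact S) : IsGPureExact (S.map (skyscraperFunctor x)) := by
  let T := (S.map (skyscraperFunctor x)).map (Scheme.Modules.toPresheafOfModules X)
  have hmono := hS.shortExact.mono_f
  have hepi := hS.shortExact.epi_g
  have hinj : Function.Injective S.f := (ModuleCat.mono_iff_injective _).mp hmono
  have hsurj : Function.Surjective S.g := (ModuleCat.epi_iff_surjective _).mp hepi
  have hex := S.moduleCat_exact_iff.mp hS.shortExact.exact
  have hT : T.ShortExact :=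
    { exact := presheaf_exact_of_app fun U => by
        rw [ShortComplex.moduleCat_exact_iff]
        intro (s : SkyscraperSections x S.X₂ U.unop) hs
        by_cases hx : x ∈ U.unop
        · obtain ⟨m, hm⟩ := hex (s ⟨hx⟩) (congrFun (hs : (_ : SkyscraperSections x S.X₃ U.unop) = 0)
            ⟨hx⟩)
          exact ⟨(fun _ => m : SkyscraperSections x S.X₁ U.unop),
            funext fun _ : PLift (x ∈ U.unop) => hm⟩
        · exact ⟨0, funext fun h : PLift (x ∈ U.unop) => absurd h.down hx⟩
      mono_f := PresheafOfModules.mono_of_injective fun U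
          (s t : SkyscraperSections x S.X₁ U.unop) hst =>
        funext fun h => hinj (congrFun (hst : (_ : SkyscraperSections x S.X₂ U.unop) = _) h)
      epi_g := PresheafOfModules.epi_of_surjective fun U (s : SkyscraperSections x S.X₃ U.unop) =>
        ⟨(fun h => (hsurj (s h)).choose : SkyscraperSections x S.X₂ U.unop),
          funext fun h : PLift (x ∈ U.unop) => (hsurj (s h)).choose_spec⟩ }
  refine isGPureExact_of_presheaf hT (𝟙 T) fun Y => ?_
  refine Presheaf.isLocallyInjective_of_injective _ _ fun U => ?_
  let g : SkyscraperSections x S.X₁ U.unop →ₗ[Γ(X, U.unop)] SkyscraperSections x S.X₂ U.unop :=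
    onSec ((skyscraperFunctor x).map S.f) U.unop
  let Y' : ModuleCat (X.presheaf.obj U) := Y.obj U
  change Function.Injective (g.rTensor Y')
  by_cases hx : x ∈ U.unop
  · let e (M : ModuleCat.{u} (X.presheaf.stalk x)) : SkyscraperSections x M U.unop ≃+ M :=
      { toFun := fun s => s ⟨hx⟩
        invFun := fun m _ => m
        left_inv := fun _ => rfl
        right_inv := fun _ => rfl
        map_add' := fun _ _ => rfl }
    refine rTensor_injective_of_restrictScalars (X.presheaf.germ U.unop x hx).hom S.f.hom g
      (e _) (fun _ _ => rfl) (e _) (fun _ _ => rfl) (fun _ => rfl) fun Z _ _ => ?_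
    have := (hS.tensor (ModuleCat.of _ Z)).mono_f
    exact (ModuleCat.mono_iff_injective _).mp this
  · have : Subsingleton (SkyscraperSections x S.X₁ U.unop) :=
      ⟨fun s t => funext fun h => absurd h.down hx⟩
    have : Subsingleton (TensorProduct (Γ(X, U.unop)) (SkyscraperSections x S.X₁ U.unop) Y') :=
      inferInstance
    exact Function.injective_of_subsingleton _

variable {x}

/-- The skyscraper functor is fully faithful, so `Hom(S, M)` is isomorphic to `Hom` from the
skyscrapers of `S` to the skyscraper of `M`. -/
lemma isPureInjective_of_skyscraper {M : ModuleCat.{u} (X.presheaf.stalk x)}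
    (hM : IsGPureInjective (skyscraper x M)) : IsPureInjective M := by
  intro S hS
  let F := skyscraperFunctor x
  let e (N : ModuleCat.{u} (X.presheaf.stalk x)) :
      AddCommGrpCat.of (N ⟶ M) ≅ AddCommGrpCat.of (F.obj N ⟶ F.obj M) :=
    AddEquiv.toAddCommGrpIso
      (AddEquiv.ofBijective F.mapAddHom ⟨F.map_injective, F.map_surjective⟩)
  let iso : (S.map F).op.map (preadditiveYoneda.obj (F.obj M)) ≅
      S.op.map (preadditiveYoneda.obj M) :=
    (ShortComplex.isoMk (S₁ := S.op.map (preadditiveYoneda.obj M))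
      (S₂ := (S.map F).op.map (preadditiveYoneda.obj (F.obj M))) (e S.X₃) (e S.X₂) (e S.X₁)
      (by ext φ; exact (F.map_comp S.g φ).symm) (by ext φ; exact (F.map_comp S.f φ).symm)).symm
  exact ShortComplex.shortExact_of_iso iso (hM _ (hS.skyscraper x))

lemma indecomposable_of_skyscraper {M : ModuleCat.{u} (X.presheaf.stalk x)}
    (hM : Indecomposable (skyscraper x M)) : Indecomposable M := by
  let F := skyscraperFunctor x
  have hF {N : ModuleCat.{u} (X.presheaf.stalk x)} (h : IsZero (F.obj N)) : IsZero N :=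
    (IsZero.iff_id_eq_zero N).mpr (F.map_injective (h.eq_of_src _ _))
  have := preservesBinaryBiproducts_of_preservesBiproducts F
  refine ⟨fun h => hM.1 (F.map_isZero h), fun Y Z e => ?_⟩
  exact (hM.2 _ _ (F.mapIso e ≪≫ F.mapBiprod Y Z)).imp hF hF

lemma IsGPureInjective.of_iso {A B : X.Modules} (hA : IsGPureInjective A) (e : A ≅ B) :
    IsGPureInjective B := fun S hS =>
  ShortComplex.shortExact_of_iso (S.op.mapNatIso (preadditiveYoneda.mapIso e)) (hA S hS)

lemma indecomposable_of_iso {C : Type*} [Category* C] [HasZeroMorphisms C] [HasBinaryBiproducts C]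
    {A B : C} (hA : Indecomposable A) (e : A ≅ B) : Indecomposable B :=
  ⟨fun h => hA.1 (h.of_iso e), fun Y Z i => hA.2 Y Z (e ≪≫ i)⟩

end

end GPurity

end

theorem mainTheorem7 {X : AlgebraicGeometry.Scheme.{u}} (N : X.Modules)
    (hind : CategoryTheory.Indecomposable N) (hinj : GPurity.IsGPureInjective N) :
    ∃ (x : X) (M : ModuleCat.{u} (X.presheaf.stalk x)),
      CategoryTheory.Indecomposable M ∧ GPurity.IsPureInjective M ∧
        Nonempty (N ≅ GPurity.skyscraper x M) := by
  obtain ⟨r, hr⟩ := hinj.exists_retraction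
  obtain ⟨x, h₀, h⟩ := GPurity.exists_generic_point hind.1
    (GPurity.subsingleton_or_bijective_of_retraction hind r hr)
  have := GPurity.isIso_toSkyscraper x h₀ h
  let e := asIso (GPurity.toSkyscraper N x)
  exact ⟨x, GPurity.stalkModule N x,
    GPurity.indecomposable_of_skyscraper (GPurity.indecomposable_of_iso hind e),
    GPurity.isPureInjective_of_skyscraper (hinj.of_iso e), ⟨e⟩⟩
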